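/- Let $n,k\ge 0$ be integers with $k<\frac{n+1}{2}$, and for $m\ge 0$ let $\mathcal H_m=(\mathbb C^2)^{\otimes m}$ be the space of $m$ qubits. Let $\rho$ be a state (a positive semidefinite operator of trace one) on $\mathcal H_k\otimes\mathcal H_{n-k+1}$ which has two eigenvalues $\lambda_1>\lambda_2$, each of multiplicity $2^n$ (so these are all its eigenvalues). Then $\rho$ is PPT from spectrum, i.e. for every unitary $U$ on $\mathcal H_k\otimes\mathcal H_{n-k+1}$ the partial transpose $(T\otimes \mathbb 1)(U\rho U^\dagger)$ is positive semidefinite ($T$ being transposition on $\mathcal H_k$ in the computational basis), if and only if $$\tfrac12(\lambda_1+\lambda_2)-2^{k-1}(\lambda_1-\lambda_2)\ \ge\ 0 .$$ -/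

import Mathlib

open scoped Kronecker ComplexOrder

/-- Labels of the computational basis of `m` qubits, i.e. of `(ℂ²)^{⊗ m}`: bit strings of
length `m`. Operators on the `m`-qubit space are matrices indexed by `QubitIndex m`, and operators
on a tensor product of two such spaces are matrices indexed by a product of two label sets. -/
abbrev QubitIndex (m : ℕ) : Type := Fin m → Fin 2

section Bipartite

variable {A B : Type*}

/-- A (mixed) quantum state: a positive semidefinite matrix of trace one. -/
structure IsState {ι : Type*} [Fintype ι] (ρ : Matrix ι ι ℂ) : Prop where
  posSemidef : ρ.PosSemidef
  trace_eq_one : ρ.trace = 1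

/-- The partial transpose `(T ⊗ 1)(ρ)` on the first tensor factor. -/
def partialTranspose (ρ : Matrix (A × B) (A × B) ℂ) : Matrix (A × B) (A × B) ℂ :=
  Matrix.of fun x y => ρ (y.1, x.2) (x.1, y.2)

/-- On product operators the partial transpose acts as `X ⊗ Y ↦ Xᵀ ⊗ Y`. -/
theorem partialTranspose_kronecker (X : Matrix A A ℂ) (Y : Matrix B B ℂ) :
    partialTranspose (X ⊗ₖ Y) = X.transpose ⊗ₖ Y := rfl

/-- `ρ` is PPT (has positive partial transpose). -/
def IsPPT (ρ : Matrix (A × B) (A × B) ℂ) : Prop :=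
  (partialTranspose ρ).PosSemidef

/-- `ρ` is PPT from spectrum: `U ρ U†` is PPT for every unitary `U` on the whole tensor
product. -/
def IsPPTFromSpectrum [Fintype A] [Fintype B] [DecidableEq A] [DecidableEq B]
    (ρ : Matrix (A × B) (A × B) ℂ) : Prop :=
  ∀ U ∈ Matrix.unitaryGroup (A × B) ℂ, IsPPT (U * ρ * U.conjTranspose)

end Bipartite

/-- The multiplicity (degeneracy) of the number `c` as an eigenvalue of `M`: the dimension of its
eigenspace (zero if `c` is not an eigenvalue). -/
noncomputable def eigenMultiplicity {ι : Type*} [Fintype ι] [DecidableEq ι]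
    (M : Matrix ι ι ℂ) (c : ℂ) : ℕ :=
  Module.finrank ℂ (Module.End.eigenspace (Matrix.toLin' M) c)

/-! ### Hermitian matrices with two eigenvalues -/

section HermitianSpectrum

open Matrix Polynomial

variable {ι : Type*} [Fintype ι] [DecidableEq ι]

/-! Put s = (l₁ + l₂)/2 and t = (l₁ - l₂)/2 > 0. The Hermitian matrices with spectrum l₁, l₂ in
equal multiplicity are exactly s·1 + t·S with S a traceless Hermitian involution, and they form one
unitary orbit. PPT from spectrum therefore asks that s·1 + t·S^Γ ≥ 0 for all such S, where Γ is the
partial transpose on A.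

A sum of squares gives S^Γ ≥ -|A| (`posSemidef_card_add_partialTranspose`), so s - |A| t ≥ 0
suffices. The bound is attained when B contains a copy of A and a sign bit: swapping A with its copy
has partial transpose |A| times the projection onto the maximally entangled vector, and the sign bit
both flips this to -|A| and makes the trace vanish (`signedSwap`). With |A| = 2^k this is the stated
inequality. -/

/-- Rank-nullity, with the rank of `M - c • 1` read off after unitary diagonalisation. -/
theorem eigenMultiplicity_eq_card {M : Matrix ι ι ℂ} (hM : M.IsHermitian) (c : ℝ) :
    eigenMultiplicity M (c : ℂ) = Fintype.card {i // hM.eigenvalues i = c} := by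
  have hker : eigenMultiplicity M (c : ℂ) + (M - (c : ℂ) • (1 : Matrix ι ι ℂ)).rank =
      Fintype.card ι := by
    have h := LinearMap.finrank_range_add_finrank_ker
      (Matrix.toLin' (M - (c : ℂ) • (1 : Matrix ι ι ℂ)))
    rw [Module.finrank_fintype_fun_eq_card] at h
    rw [eigenMultiplicity, Module.End.eigenspace_def, ← h, add_comm]
    congr 1
    rw [map_sub, map_smul, Matrix.toLin'_one]
    rfl
  have hdiag : M - (c : ℂ) • (1 : Matrix ι ι ℂ) = (hM.eigenvectorUnitary : Matrix ι ι ℂ) *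
      diagonal (fun i => ((hM.eigenvalues i - c : ℝ) : ℂ)) *
        star (hM.eigenvectorUnitary : Matrix ι ι ℂ) := by
    have hD : diagonal (fun i => ((hM.eigenvalues i - c : ℝ) : ℂ)) =
        diagonal (RCLike.ofReal ∘ hM.eigenvalues) - (c : ℂ) • (1 : Matrix ι ι ℂ) := by
      ext i j
      by_cases h : i = j <;> simp [h]
    conv_lhs => rw [hM.spectral_theorem, Unitary.conjStarAlgAut_apply]
    rw [hD, mul_sub, sub_mul]
    simp
  have hrank : (M - (c : ℂ) • (1 : Matrix ι ι ℂ)).rank =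
      Fintype.card {i // hM.eigenvalues i ≠ c} := by
    rw [hdiag, ← Unitary.coe_star]
    simp only [rank_mul_eq_left_of_isUnit_det _ _ (UnitaryGroup.det_isUnit _),
      rank_mul_eq_right_of_isUnit_det _ _ (UnitaryGroup.det_isUnit _), rank_diagonal]
    refine Fintype.card_congr (Equiv.subtypeEquivRight fun i => ?_)
    rw [ne_eq, Complex.ofReal_eq_zero, sub_eq_zero]
  have hcompl := Fintype.card_subtype_compl (fun i => hM.eigenvalues i = c)
  have hle := Fintype.card_subtype_le (fun i => hM.eigenvalues i = c)
  simp only [ne_eq] at hrank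
  omega

theorem charpoly_eq_of_two_eigenvalues {M : Matrix ι ι ℂ} (hM : M.IsHermitian) {l₁ l₂ : ℝ}
    (hl : l₁ ≠ l₂) (h : ∀ i, hM.eigenvalues i = l₁ ∨ hM.eigenvalues i = l₂) :
    M.charpoly = (X - C (l₁ : ℂ)) ^ Fintype.card {i // hM.eigenvalues i = l₁} *
      (X - C (l₂ : ℂ)) ^ Fintype.card {i // hM.eigenvalues i = l₂} := by
  rw [hM.charpoly_eq, ← Finset.prod_filter_mul_prod_filter_not Finset.univ
    (fun i => hM.eigenvalues i = l₁), Fintype.card_subtype, Fintype.card_subtype]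
  congr 1
  · refine Finset.prod_eq_pow_card fun i hi => ?_
    rw [(Finset.mem_filter.1 hi).2]
    rfl
  · rw [show Finset.univ.filter (fun i => hM.eigenvalues i = l₂) =
        Finset.univ.filter (fun i => ¬ hM.eigenvalues i = l₁) from ?_]
    · refine Finset.prod_eq_pow_card fun i hi => ?_
      rw [(h i).resolve_left (Finset.mem_filter.1 hi).2]
      rfl
    · refine Finset.filter_congr fun i _ => ⟨fun h2 h1 => hl (h1.symm.trans h2), (h i).resolve_left⟩

theorem eigenvalues_mem_pair {M : Matrix ι ι ℂ} (hM : M.IsHermitian) {l₁ l₂ : ℝ} (hl : l₁ ≠ l₂)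
    (h : Fintype.card {i // hM.eigenvalues i = l₁} + Fintype.card {i // hM.eigenvalues i = l₂} =
      Fintype.card ι) (i : ι) : hM.eigenvalues i = l₁ ∨ hM.eigenvalues i = l₂ := by
  rw [Fintype.card_subtype, Fintype.card_subtype, ← Finset.card_union_of_disjoint,
    ← Finset.filter_or, Finset.card_eq_iff_eq_univ] at h
  · simpa using Finset.ext_iff.1 h i
  · exact Finset.disjoint_filter.2 fun i _ h1 h2 => hl (h1.symm.trans h2)

theorem mul_eq_zero_of_two_eigenvalues {M : Matrix ι ι ℂ} (hM : M.IsHermitian) {l₁ l₂ : ℝ}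
    (h : ∀ i, hM.eigenvalues i = l₁ ∨ hM.eigenvalues i = l₂) :
    (M - (l₁ : ℂ) • (1 : Matrix ι ι ℂ)) * (M - (l₂ : ℂ) • (1 : Matrix ι ι ℂ)) = 0 := by
  have hD : ((diagonal (RCLike.ofReal ∘ hM.eigenvalues) : Matrix ι ι ℂ) - (l₁ : ℂ) • 1) *
      (diagonal (RCLike.ofReal ∘ hM.eigenvalues) - (l₂ : ℂ) • 1) = 0 := by
    rw [smul_one_eq_diagonal, smul_one_eq_diagonal, diagonal_sub, diagonal_sub,
      diagonal_mul_diagonal, ← diagonal_zero]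
    congr 1
    funext i
    rcases h i with h | h <;> simp [h]
  have := congrArg (Unitary.conjStarAlgAut ℂ _ hM.eigenvectorUnitary) hD
  rwa [map_mul, map_sub, map_sub, map_smul, map_smul, map_one, map_zero,
    ← hM.spectral_theorem] at this

/-- A Hermitian matrix annihilated by `(X - l₁) (X - l₂)` whose trace is that of a matrix with
equally many eigenvalues `l₁` and `l₂` has equally many of both. -/
theorem charpoly_eq_of_mul_eq_zero {M : Matrix ι ι ℂ} (hM : M.IsHermitian) {l₁ l₂ : ℝ}
    (hl : l₁ ≠ l₂) {m : ℕ} (hm : Fintype.card ι = m + m)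
    (h : (M - (l₁ : ℂ) • (1 : Matrix ι ι ℂ)) * (M - (l₂ : ℂ) • (1 : Matrix ι ι ℂ)) = 0)
    (htr : M.trace = m * (l₁ + l₂)) :
    M.charpoly = (X - C (l₁ : ℂ)) ^ m * (X - C (l₂ : ℂ)) ^ m := by
  have hpair : ∀ i, hM.eigenvalues i = l₁ ∨ hM.eigenvalues i = l₂ := by
    have hD := congrArg (Unitary.conjStarAlgAut ℂ _ (star hM.eigenvectorUnitary)) h
    rw [map_mul, map_sub, map_sub, map_smul, map_smul, map_one, map_zero,
      hM.conjStarAlgAut_star_eigenvectorUnitary, smul_one_eq_diagonal, smul_one_eq_diagonal,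
      diagonal_sub, diagonal_sub, diagonal_mul_diagonal, ← diagonal_zero, diagonal_injective.eq_iff]
      at hD
    intro i
    have hi := congrFun hD i
    simp only [Function.comp_apply, mul_eq_zero, sub_eq_zero] at hi
    exact hi.imp (fun h => Complex.ofReal_injective h) (fun h => Complex.ofReal_injective h)
  rw [charpoly_eq_of_two_eigenvalues hM hl hpair]
  have hcard : Fintype.card {i // hM.eigenvalues i = l₁} +
      Fintype.card {i // hM.eigenvalues i = l₂} = m + m := by
    rw [← hm, Fintype.card_subtype, Fintype.card_subtype, ← Finset.card_union_of_disjoint,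
      ← Finset.filter_or, Finset.card_eq_iff_eq_univ]
    · exact Finset.filter_true_of_mem fun i _ => hpair i
    · exact Finset.disjoint_filter.2 fun i _ h1 h2 => hl (h1.symm.trans h2)
  have hsum : ∑ i, hM.eigenvalues i = m * (l₁ + l₂) := by
    rw [hM.trace_eq_sum_eigenvalues] at htr
    have := congrArg Complex.re htr
    simpa using this
  -- After subtracting l₂ only the eigenvalues l₁ contribute, so the trace determines how many there
  -- are.
  have hsum' : ∑ i, (hM.eigenvalues i - l₂) =
      Fintype.card {i // hM.eigenvalues i = l₁} * (l₁ - l₂) := by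
    rw [Fintype.card_subtype, ← nsmul_eq_mul, ← Finset.sum_const, Finset.sum_filter]
    refine Finset.sum_congr rfl fun i _ => ?_
    split_ifs with hi
    · rw [hi]
    · rw [(hpair i).resolve_left hi, sub_self]
  rw [Finset.sum_sub_distrib, hsum, Finset.sum_const, Finset.card_univ, hm, nsmul_eq_mul] at hsum'
  have h1 : (m : ℝ) = Fintype.card {i // hM.eigenvalues i = l₁} := by
    refine mul_right_cancel₀ (sub_ne_zero.2 hl) ?_
    rw [← hsum']
    push_cast
    ring
  have h1' : m = Fintype.card {i // hM.eigenvalues i = l₁} := by exact_mod_cast h1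
  rw [← h1', show Fintype.card {i // hM.eigenvalues i = l₂} = m by omega]

/-- Hermitian matrices with the same characteristic polynomial are unitarily equivalent. -/
theorem exists_unitary_conj_of_charpoly_eq {M N : Matrix ι ι ℂ} (hM : M.IsHermitian)
    (hN : N.IsHermitian) (h : M.charpoly = N.charpoly) :
    ∃ U ∈ unitaryGroup ι ℂ, U * M * Uᴴ = N := by
  refine ⟨_, (hN.eigenvectorUnitary * star hM.eigenvectorUnitary).2, ?_⟩
  have := Unitary.conjStarAlgAut_apply (S := ℂ)
    (hN.eigenvectorUnitary * star hM.eigenvectorUnitary) M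
  rw [← star_eq_conjTranspose]
  refine this.symm.trans ?_
  rw [Unitary.conjStarAlgAut_mul_apply, hM.conjStarAlgAut_star_eigenvectorUnitary,
    (hM.eigenvalues_eq_eigenvalues_iff hN).2 h, ← hN.spectral_theorem]

/-- For l₁ ≠ l₂, being annihilated by (X - l₁)(X - l₂) thus amounts to S² = 1; both implications are
needed. -/
theorem affine_mul_affine_eq_smul (S : Matrix ι ι ℂ) (l₁ l₂ : ℝ) :
    ((((l₁ + l₂) / 2 : ℝ) : ℂ) • (1 : Matrix ι ι ℂ) + (((l₁ - l₂) / 2 : ℝ) : ℂ) • S -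
        (l₁ : ℂ) • 1) *
      ((((l₁ + l₂) / 2 : ℝ) : ℂ) • (1 : Matrix ι ι ℂ) + (((l₁ - l₂) / 2 : ℝ) : ℂ) • S -
        (l₂ : ℂ) • 1) =
      (((l₁ - l₂) / 2 : ℝ) : ℂ) ^ 2 • (S * S - 1) := by
  simp only [sub_mul, add_mul, mul_sub, mul_add, smul_mul_smul_comm, one_mul, mul_one]
  push_cast
  module

end HermitianSpectrum

/-! ### Lower bound for the partial transpose of an involution -/

section PartialTranspose

open Matrix

variable {A B : Type*} [DecidableEq A] [DecidableEq B]

theorem partialTranspose_affine (S : Matrix (A × B) (A × B) ℂ) (s t : ℂ) :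
    partialTranspose (s • (1 : Matrix (A × B) (A × B) ℂ) + t • S) =
      s • (1 : Matrix (A × B) (A × B) ℂ) + t • partialTranspose S := by
  ext x y
  have : (y.1 = x.1 ∧ x.2 = y.2) ↔ (x.1 = y.1 ∧ x.2 = y.2) := by rw [eq_comm]
  simp only [partialTranspose, of_apply, Matrix.add_apply, Matrix.smul_apply, one_apply,
    Prod.ext_iff, this]

variable [Fintype A] [Fintype B]

/-- In this form the partial transpose appears as the cross terms of a sum of squares. -/
theorem partialTranspose_eq_sum (S : Matrix (A × B) (A × B) ℂ) :
    partialTranspose S = ∑ i, ∑ j, (single j i (1 : ℂ) ⊗ₖ (1 : Matrix B B ℂ)) * S *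
      (single j i (1 : ℂ) ⊗ₖ (1 : Matrix B B ℂ)) := by
  ext ⟨a, b⟩ ⟨a', b'⟩
  simp only [Matrix.sum_apply, Matrix.mul_apply, kroneckerMap_apply, single_apply, one_apply,
    Fintype.sum_prod_type, partialTranspose, of_apply, ite_and, mul_ite, ite_mul, mul_one, one_mul,
    mul_zero, zero_mul, Finset.sum_ite_eq, Finset.sum_ite_eq', Finset.mem_univ, if_true,
    Finset.sum_const_zero, Finset.sum_ite_irrel]

/-- The partial transpose on the factor `A` of a Hermitian unitary is bounded below by
`-|A|`. -/
theorem posSemidef_card_add_partialTranspose {S : Matrix (A × B) (A × B) ℂ} (hS : S.IsHermitian)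
    (hS2 : S * S = 1) :
    ((Fintype.card A : ℂ) • (1 : Matrix (A × B) (A × B) ℂ) + partialTranspose S).PosSemidef := by
  let E : A → A → Matrix (A × B) (A × B) ℂ := fun i j => single i j (1 : ℂ) ⊗ₖ (1 : Matrix B B ℂ)
  have hE : ∀ i j, (E i j)ᴴ = E j i := fun i j => by
    simp [E, conjTranspose_kronecker, conjTranspose_single]
  have hEE : ∀ i j, E j i * E i j = E j j := fun i j => by
    simp [E, ← mul_kronecker_mul]
  have hsum : ∑ i, E i i = 1 := by
    ext ⟨a, b⟩ ⟨a', b'⟩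
    by_cases h : b = b' <;>
      simp [E, Matrix.sum_apply, single_apply, one_apply, ite_and, Prod.ext_iff, h]
  -- Summed over i and j, the first two terms give 2|A|·1 and the cross terms give 2S^Γ.
  have hterm : ∀ i j, (E i j + S * E j i)ᴴ * (E i j + S * E j i) =
      E j j + E i i + (E j i * S * E j i + E i j * S * E i j) := fun i j => by
    rw [conjTranspose_add, conjTranspose_mul, hE, hE, hS.eq, add_mul, mul_add, mul_add, hEE,
      ← mul_assoc (E j i) S, ← mul_assoc (E i j * S) S, mul_assoc (E i j) S S, hS2, mul_one, hEE]
    abel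
  have hid : (Fintype.card A : ℂ) • (1 : Matrix (A × B) (A × B) ℂ) + partialTranspose S =
      (1 / 2 : ℂ) • ∑ i, ∑ j, (E i j + S * E j i)ᴴ * (E i j + S * E j i) := by
    have h1 : ∑ i, ∑ j, E j i * S * E j i = partialTranspose S := (partialTranspose_eq_sum S).symm
    have h2 : ∑ i, ∑ j, E i j * S * E i j = partialTranspose S := by rw [Finset.sum_comm, h1]
    have h3 : ∑ _i : A, (1 : Matrix (A × B) (A × B) ℂ) = (Fintype.card A : ℂ) • 1 := by
      rw [Finset.sum_const, Finset.card_univ, Nat.cast_smul_eq_nsmul]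
    have h4 : ∑ i, ∑ _j : A, E i i = (Fintype.card A : ℂ) • 1 := by
      rw [Finset.sum_comm, hsum, h3]
    simp only [hterm, Finset.sum_add_distrib, h1, h2, hsum, h3, h4]
    rw [← two_smul ℂ, ← two_smul ℂ, ← smul_add, smul_smul]
    norm_num
  rw [hid]
  refine PosSemidef.smul ?_ (by positivity)
  exact posSemidef_sum _ fun i _ => posSemidef_sum _ fun j _ => posSemidef_conjTranspose_mul_self _

end PartialTranspose

/-! ### The extremal involution -/

section SignedSwap

open Matrix

variable {A B : Type*} {m : ℕ}

/-- The involution of `A × B` that swaps `A` with its copy inside `B ≃ A × Fin m × Bool`. -/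
def swapFactor (e : B ≃ A × Fin m × Bool) (x : A × B) : A × B :=
  ((e x.2).1, e.symm (x.1, (e x.2).2))

theorem swapFactor_swapFactor (e : B ≃ A × Fin m × Bool) (x : A × B) :
    swapFactor e (swapFactor e x) = x := by
  simp [swapFactor]

variable [DecidableEq B]

/-- A test vector: the unnormalised maximally entangled vector of `A` and its copy in `B`, in a
sector of sign `-1`. -/
def maxEntangled (e : B ≃ A × Fin m × Bool) (p : Fin m) (x : A × B) : ℂ :=
  if x.2 = e.symm (x.1, p, false) then 1 else 0

theorem star_maxEntangled_dotProduct_self [Fintype A] [Fintype B] (e : B ≃ A × Fin m × Bool) (p : Fin m) :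
    star (maxEntangled e p) ⬝ᵥ maxEntangled e p = Fintype.card A := by
  simp [dotProduct, maxEntangled, Fintype.sum_prod_type, apply_ite]

variable [DecidableEq A]

/-- The operator `F ⊗ D`, where `F` swaps `A` with its copy inside `B ≃ A × Fin m × Bool` and `D` is
the diagonal of signs given by the `Bool` factor. -/
def signedSwap (e : B ≃ A × Fin m × Bool) : Matrix (A × B) (A × B) ℂ :=
  Matrix.of fun x y => if y = swapFactor e x then (if (e x.2).2.2 then 1 else -1) else 0

theorem signedSwap_isHermitian (e : B ≃ A × Fin m × Bool) : (signedSwap e).IsHermitian := by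
  ext x y
  rw [conjTranspose_apply, signedSwap, of_apply, of_apply]
  by_cases h : y = swapFactor e x
  · subst h
    rw [if_pos (swapFactor_swapFactor e x).symm, if_pos rfl]
    by_cases hb : (e x.2).2.2 = true <;> simp [swapFactor, hb]
  · rw [if_neg h, if_neg, star_zero]
    rintro rfl
    exact h (swapFactor_swapFactor e y).symm

variable [Fintype A] [Fintype B]

theorem signedSwap_mul_self (e : B ≃ A × Fin m × Bool) : signedSwap e * signedSwap e = 1 := by
  ext x y
  rw [Matrix.mul_apply, Finset.sum_eq_single (swapFactor e x)]
  · rw [signedSwap, of_apply, of_apply, if_pos rfl, swapFactor_swapFactor, one_apply]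
    by_cases h : x = y
    · by_cases hb : (e y.2).2.2 = true <;> simp [h, hb, swapFactor]
    · simp [h, Ne.symm h]
  · intro z _ hz
    rw [signedSwap, of_apply, if_neg hz, zero_mul]
  · simp

/-- For each b exactly one (a, b) is fixed by the swap, and the signs cancel over the `Bool` factor.
-/
theorem trace_signedSwap (e : B ≃ A × Fin m × Bool) : (signedSwap e).trace = 0 := by
  have hx : ∀ a b, (a, b) = swapFactor e (a, b) ↔ a = (e b).1 := fun a b => by
    simp only [swapFactor, Prod.ext_iff, Equiv.eq_symm_apply, and_true]
    exact ⟨fun h => h.1, fun h => ⟨h, h.symm⟩⟩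
  simp only [trace, diag_apply, signedSwap, of_apply, Fintype.sum_prod_type, hx]
  rw [Finset.sum_comm, ← e.symm.sum_comp]
  simp [Fintype.sum_prod_type]

/-- Shows that the lower bound -|A| is attained. -/
theorem partialTranspose_signedSwap_mulVec (e : B ≃ A × Fin m × Bool) (p : Fin m) :
    partialTranspose (signedSwap e) *ᵥ maxEntangled e p =
      (-(Fintype.card A : ℂ)) • maxEntangled e p := by
  ext ⟨a, b⟩
  obtain ⟨⟨c, q, s⟩, rfl⟩ := e.symm.surjective b
  have hterm : ∀ a' b', partialTranspose (signedSwap e) (a, e.symm (c, q, s)) (a', b') *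
      maxEntangled e p (a', b') =
        if b' = e.symm (a', p, false) then -maxEntangled e p (a, e.symm (c, q, s)) else 0 := by
    intro a' b'
    obtain ⟨⟨c', q', s'⟩, rfl⟩ := e.symm.surjective b'
    simp only [partialTranspose, signedSwap, swapFactor, maxEntangled, of_apply, Prod.ext_iff,
      Equiv.apply_symm_apply, e.symm.injective.eq_iff, mul_ite, mul_one, mul_zero]
    split_ifs <;> grind
  simp only [mulVec, dotProduct, Fintype.sum_prod_type, hterm, Finset.sum_ite_eq', Finset.mem_univ,
    if_true, Finset.sum_const, Finset.card_univ, nsmul_eq_mul, Pi.smul_apply, smul_eq_mul]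
  ring

end SignedSwap

/-! ### The criterion and its specialisation to qubits -/

section Main

open Matrix

variable {A B : Type*} [Fintype A] [Fintype B] [DecidableEq A] [DecidableEq B]

theorem isPPT_affine_of_involution {S : Matrix (A × B) (A × B) ℂ} (hS : S.IsHermitian)
    (hS2 : S * S = 1) {s t : ℝ} (ht : 0 ≤ t) (hst : 0 ≤ s - Fintype.card A * t) :
    IsPPT ((s : ℂ) • (1 : Matrix (A × B) (A × B) ℂ) + (t : ℂ) • S) := by
  have h : partialTranspose ((s : ℂ) • (1 : Matrix (A × B) (A × B) ℂ) + (t : ℂ) • S) =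
      ((s - Fintype.card A * t : ℝ) : ℂ) • (1 : Matrix (A × B) (A × B) ℂ) +
        (t : ℂ) • ((Fintype.card A : ℂ) • (1 : Matrix (A × B) (A × B) ℂ) + partialTranspose S) := by
    rw [partialTranspose_affine, smul_add, smul_smul, ← add_assoc, ← add_smul]
    congr 2
    push_cast
    ring
  rw [IsPPT, h]
  exact (PosSemidef.one.smul (by exact_mod_cast hst)).add
    ((posSemidef_card_add_partialTranspose hS hS2).smul (by exact_mod_cast ht))

theorem nonneg_of_isPPT_signedSwap [Nonempty A] {m : ℕ} (e : B ≃ A × Fin m × Bool) (p : Fin m)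
    {s t : ℝ} (h : IsPPT ((s : ℂ) • (1 : Matrix (A × B) (A × B) ℂ) + (t : ℂ) • signedSwap e)) :
    0 ≤ s - Fintype.card A * t := by
  rw [IsPPT, partialTranspose_affine] at h
  have h2 := h.dotProduct_mulVec_nonneg (maxEntangled e p)
  rw [add_mulVec, smul_mulVec, smul_mulVec, one_mulVec, partialTranspose_signedSwap_mulVec,
    smul_smul, ← add_smul, dotProduct_smul, star_maxEntangled_dotProduct_self, smul_eq_mul] at h2
  have h3 : (0 : ℝ) ≤ (s + t * -(Fintype.card A)) * Fintype.card A := by exact_mod_cast h2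
  have h4 := nonneg_of_mul_nonneg_left h3 (by exact_mod_cast Fintype.card_pos)
  linarith

theorem isPPTFromSpectrum_iff_of_two_eigenvalues [Nonempty A] {m : ℕ} (e : B ≃ A × Fin m × Bool)
    (p : Fin m) {ρ : Matrix (A × B) (A × B) ℂ} (hρ : ρ.IsHermitian) {l₁ l₂ : ℝ} (hl : l₂ < l₁)
    {d : ℕ} (hd : Fintype.card (A × B) = d + d) (h₁ : eigenMultiplicity ρ (l₁ : ℂ) = d)
    (h₂ : eigenMultiplicity ρ (l₂ : ℂ) = d) :
    IsPPTFromSpectrum ρ ↔ 0 ≤ (l₁ + l₂) / 2 - Fintype.card A * ((l₁ - l₂) / 2) := by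
  rw [eigenMultiplicity_eq_card hρ] at h₁ h₂
  have hpair := eigenvalues_mem_pair hρ hl.ne' (by rw [h₁, h₂, hd])
  have ht : (l₁ - l₂) / 2 ≠ 0 := (half_pos (sub_pos.2 hl)).ne'
  have htC : (((l₁ - l₂) / 2 : ℝ) : ℂ) ≠ 0 := Complex.ofReal_ne_zero.2 ht
  constructor
  · intro h
    -- N has the spectrum of ρ, so it lies in the unitary orbit of ρ and must be PPT.
    set N : Matrix (A × B) (A × B) ℂ :=
      (((l₁ + l₂) / 2 : ℝ) : ℂ) • (1 : Matrix (A × B) (A × B) ℂ) +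
        (((l₁ - l₂) / 2 : ℝ) : ℂ) • signedSwap e with hN
    have hNh : N.IsHermitian := by
      rw [IsHermitian, hN, conjTranspose_add, conjTranspose_smul, conjTranspose_smul,
        conjTranspose_one, (signedSwap_isHermitian e).eq]
      simp only [RCLike.star_def, Complex.conj_ofReal]
    have hquad : (N - (l₁ : ℂ) • (1 : Matrix (A × B) (A × B) ℂ)) *
        (N - (l₂ : ℂ) • (1 : Matrix (A × B) (A × B) ℂ)) = 0 := by
      rw [hN, affine_mul_affine_eq_smul, signedSwap_mul_self, sub_self, smul_zero]
    have htr : N.trace = d * (l₁ + l₂) := by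
      rw [hN, trace_add, trace_smul, trace_smul, trace_signedSwap, trace_one, hd]
      push_cast
      simp only [smul_eq_mul]
      ring
    obtain ⟨U, hU, hUN⟩ := exists_unitary_conj_of_charpoly_eq hρ hNh
      (by rw [charpoly_eq_of_mul_eq_zero hNh hl.ne' hd hquad htr,
        charpoly_eq_of_two_eigenvalues hρ hl.ne' hpair, h₁, h₂])
    have := h U hU
    rw [hUN] at this
    exact nonneg_of_isPPT_signedSwap e p this
  · intro h U hU
    have hUU : Uᴴ * U = 1 := (mem_unitaryGroup_iff').1 hU
    have hUU' : U * Uᴴ = 1 := (mem_unitaryGroup_iff).1 hU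
    set s : ℂ := (((l₁ + l₂) / 2 : ℝ) : ℂ) with hs
    set t : ℂ := (((l₁ - l₂) / 2 : ℝ) : ℂ) with hT
    -- The rescaling that sends l₁, l₂ to 1, -1.
    set S : Matrix (A × B) (A × B) ℂ := t⁻¹ • (ρ - s • 1) with hSdef
    have hSh : S.IsHermitian := by
      rw [IsHermitian, hSdef, conjTranspose_smul, conjTranspose_sub, conjTranspose_smul,
        conjTranspose_one, hρ.eq, star_inv₀]
      simp only [hs, hT, RCLike.star_def, Complex.conj_ofReal]
    have hρS : ρ = s • 1 + t • S := by
      rw [hSdef, smul_smul, mul_inv_cancel₀ htC, one_smul, add_sub_cancel]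
    have hS2 : S * S = 1 := by
      have hquad := mul_eq_zero_of_two_eigenvalues hρ hpair
      rw [hρS, hs, hT, affine_mul_affine_eq_smul, smul_eq_zero_iff_right (pow_ne_zero 2 htC)]
        at hquad
      exact sub_eq_zero.1 hquad
    have hconj : U * ρ * Uᴴ = s • 1 + t • (U * S * Uᴴ) := by
      conv_lhs => rw [hρS]
      rw [mul_add, add_mul, mul_smul_comm, mul_smul_comm, smul_mul_assoc, smul_mul_assoc, mul_one,
        hUU']
    rw [hconj]
    refine isPPT_affine_of_involution (isHermitian_mul_mul_conjTranspose U hSh) ?_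
      (half_pos (sub_pos.2 hl)).le h
    calc U * S * Uᴴ * (U * S * Uᴴ) = U * S * (Uᴴ * U) * S * Uᴴ := by simp only [mul_assoc]
      _ = U * (S * S) * Uᴴ := by rw [hUU, mul_one, mul_assoc U S S]
      _ = 1 := by rw [hS2, mul_one, hUU']

end Main

theorem mainTheorem4 (n k : ℕ) (hk : (k : ℝ) < ((n : ℝ) + 1) / 2)
    (ρ : Matrix (QubitIndex k × QubitIndex (n - k + 1)) (QubitIndex k × QubitIndex (n - k + 1)) ℂ)
    (hρ : IsState ρ) (l₁ l₂ : ℝ) (hl : l₂ < l₁)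
    (h₁ : eigenMultiplicity ρ (l₁ : ℂ) = 2 ^ n)
    (h₂ : eigenMultiplicity ρ (l₂ : ℂ) = 2 ^ n) :
    IsPPTFromSpectrum ρ ↔
      0 ≤ (1 / 2 : ℝ) * (l₁ + l₂) - (2 : ℝ) ^ ((k : ℤ) - 1) * (l₁ - l₂) := by
  -- This leaves room in the second factor for k qubits, one sign qubit and n - 2k spare ones.
  have hk' : 2 * k ≤ n := by
    have : (2 * k : ℝ) < n + 1 := by linarith
    exact_mod_cast Nat.lt_succ_iff.1 (by exact_mod_cast this)
  have hB : Fintype.card (QubitIndex (n - k + 1)) =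
      Fintype.card (QubitIndex k × Fin (2 ^ (n - 2 * k)) × Bool) := by
    simp only [Fintype.card_prod, Fintype.card_fun, Fintype.card_fin, Fintype.card_bool]
    rw [← pow_succ, ← pow_add]
    congr 1
    omega
  have hd : Fintype.card (QubitIndex k × QubitIndex (n - k + 1)) = 2 ^ n + 2 ^ n := by
    simp only [Fintype.card_prod, Fintype.card_fun, Fintype.card_fin]
    rw [← two_mul, ← pow_succ', ← pow_add]
    congr 1
    omega
  rw [isPPTFromSpectrum_iff_of_two_eigenvalues (Fintype.equivOfCardEq hB) ⟨0, by positivity⟩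
    hρ.posSemidef.isHermitian hl hd h₁ h₂]
  have hpow : (2 : ℝ) ^ ((k : ℤ) - 1) = 2 ^ k / 2 := by
    rw [zpow_sub₀ two_ne_zero, zpow_natCast, zpow_one]
  rw [hpow, Fintype.card_fun, Fintype.card_fin, Fintype.card_fin]
  push_cast
  ring_nf
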